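/- Let $q$ be a prime power and $\mathcal M_q$ the multiplicative monoid of monic polynomials in $\mathbb F_q[T]$, with $|f|=q^{\deg f}$. Let $\mathcal M_q^{gl}\subset\mathcal M_q$ be the set of $f\in\mathcal M_q$ coprime to $T$. For $f\in\mathcal M_q$ of degree $n$ put $$P_{GL}(f)=\frac{|\{M\in \mathrm{GL}(n,q):\ \det(T-M)=f\}|}{|\mathrm{GL}(n,q)|},\qquad P_{GL}(1)=1 .$$ For $i\ge 1$ and $g\in\mathcal M_q$ let $\alpha_i(g)=|g|^{-i}$ if $g\in\mathcal M_q^{gl}$ and $\alpha_i(g)=0$ otherwise. Write $(\alpha*\beta)(f)=\sum_{d\delta=f}\alpha(d)\beta(\delta)$, the sum being over $d,\delta\in\mathcal M_q$ with $d\delta=f$, for Dirichlet convolution on $\mathcal M_q$. For an integer $\ell\ge 0$ and a nonzero $H\in\mathbb F_q[T]$, let $R_{\ell,H}$ be the congruence on $\mathcal M_q$ under which $A\equiv B$ if and only if $H\mid A-B$ and, for $1\le j\le \ell$, the $j$-th next-to-leading coefficients of $A$ and $B$ are equal. (The $j$-th next-to-leading coefficient of $A$ is the coefficient of $T^{\deg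 A-j}$, taken to be $0$ if $j>\deg A$.) A Hayes character is a function $\chi:\mathcal M_q\to\mathbb C$ obtained, for some such $\ell,H$, from a character $\psi$ of the unit group of the quotient monoid $\mathcal M_q/R_{\ell,H}$ by setting $\chi(A)=\psi([A])$ if the class $[A]$ is a unit and $\chi(A)=0$ otherwise. Then the following hold. 1. For every $f\in\mathcal M_q$, $$P_{GL}(f)=\lim_{k\to\infty}(\alpha_1*\alpha_2*\cdots*\alpha_k)(f).$$ 2. Let $\chi$ be a Hayes character. For every $u\in\mathbb C$ with $|u|<1/q$, the series $$L_{GL}(u,\chi)=\sum_{f\in\mathcal M_q^{gl}}\chi(f)u^{\deg f}$$ converges absolutely. For every $u\in\mathbb C$ with $|u|<1$, $$\sum_{f\in\mathcal M_q}P_{GL}(f)\chi(f)u^{\deg f}=\prod_{i=1}^{\infty}L_{GL}\Big(\frac{u}{q^i},\chi\Big),$$ where the series on the left converges absolutely, and so does the product on the right, i.e. $\sum_{i\ge1}|L_{GL}(u/q^i,\chi)-1|<\infty$. -/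

import Mathlib

open Polynomial Filter Topology

noncomputable section

namespace GLCharpoly

/-- The multiplicative monoid of monic polynomials over `F`. -/
def Monics (F : Type*) [Field F] : Submonoid F[X] where
  carrier := {f | f.Monic}
  mul_mem' ha hb := Monic.mul ha hb
  one_mem' := monic_one

variable {F : Type*} [Field F]

/-! ### Hayes characters -/

/-- The `j`-th next-to-leading coefficient of `f`, that is, the coefficient of `T ^ (deg f - j)`;
it is `0` when `j > deg f`. (For `j = 0` it is the leading coefficient.) -/
def nextLeadingCoeff (f : F[X]) (j : ℕ) : F :=
  if j ≤ f.natDegree then f.coeff (f.natDegree - j) else 0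

theorem nextLeadingCoeff_eq_reverse (f : F[X]) (j : ℕ) : nextLeadingCoeff f j = f.reverse.coeff j := by
  rw [coeff_reverse, nextLeadingCoeff]
  split_ifs with h
  · rw [revAt_le h]
  · rw [revAt_eq_self_of_lt (not_le.mp h), coeff_eq_zero_of_natDegree_lt (not_le.mp h)]

theorem nextLeadingCoeff_zero_of_monic (f : Monics F) : nextLeadingCoeff (f : F[X]) 0 = 1 := by
  have h : (f : F[X]).leadingCoeff = 1 := f.2
  simpa [nextLeadingCoeff] using h

theorem nextLeadingCoeff_mul (f g : F[X]) (j : ℕ) :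
    nextLeadingCoeff (f * g) j =
      ∑ p ∈ Finset.HasAntidiagonal.antidiagonal j, nextLeadingCoeff f p.1 * nextLeadingCoeff g p.2 := by
  simp only [nextLeadingCoeff_eq_reverse, reverse_mul_of_domain, coeff_mul]

/-- The relation `R_{ℓ,H}` on monic polynomials: `A` and `B` are related when their first `ℓ`
next-to-leading coefficients agree and `A ≡ B mod H`. It is a congruence for multiplication. -/
def hayesCon (ℓ : ℕ) (H : F[X]) : Con (Monics F) where
  r A B := (∀ j, 1 ≤ j → j ≤ ℓ → nextLeadingCoeff (A : F[X]) j = nextLeadingCoeff (B : F[X]) j) ∧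
    H ∣ (A : F[X]) - (B : F[X])
  iseqv :=
    { refl := fun A => ⟨fun _ _ _ => rfl, by simp⟩
      symm := fun h => ⟨fun j h1 h2 => (h.1 j h1 h2).symm, by
        rw [← neg_sub]; exact (dvd_neg).mpr h.2⟩
      trans := fun h h' => ⟨fun j h1 h2 => (h.1 j h1 h2).trans (h'.1 j h1 h2), by
        have := dvd_add h.2 h'.2
        rwa [sub_add_sub_cancel] at this⟩ }
  mul' := by
    intro A B C D h h'
    have key : ∀ {U V : Monics F},
        (∀ j, 1 ≤ j → j ≤ ℓ → nextLeadingCoeff (U : F[X]) j = nextLeadingCoeff (V : F[X]) j) →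
        ∀ j, j ≤ ℓ → nextLeadingCoeff (U : F[X]) j = nextLeadingCoeff (V : F[X]) j := by
      intro U V hUV j hj
      rcases Nat.eq_zero_or_pos j with rfl | h0
      · rw [nextLeadingCoeff_zero_of_monic, nextLeadingCoeff_zero_of_monic]
      · exact hUV j h0 hj
    refine ⟨fun j _ hj => ?_, ?_⟩
    · simp only [Submonoid.coe_mul, nextLeadingCoeff_mul]
      refine Finset.sum_congr rfl fun p hp => ?_
      have hp' := Finset.HasAntidiagonal.mem_antidiagonal.mp hp
      rw [key h.1 p.1 (by omega), key h'.1 p.2 (by omega)]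
    · have e : ((A * C : Monics F) : F[X]) - ((B * D : Monics F) : F[X]) =
          ((A : F[X]) - B) * C + B * ((C : F[X]) - D) := by
        push_cast; ring
      rw [e]
      exact dvd_add (h.2.mul_right _) (h'.2.mul_left _)

open scoped Classical in
/-- The extension by zero to all monic polynomials of a character `ψ` of the unit group of
the quotient monoid by `R_{ℓ,H}`. -/
def hayesExtend (ℓ : ℕ) (H : F[X]) (ψ : (hayesCon ℓ H).Quotientˣ →* ℂˣ) (A : Monics F) : ℂ :=
  if h : IsUnit (A : (hayesCon ℓ H).Quotient) then ((ψ h.unit : ℂˣ) : ℂ) else 0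

/-- `χ` is a Hayes character: a character of the relation `R_{ℓ,H}` for some `ℓ ≥ 0` and some
nonzero polynomial `H`. -/
def IsHayesCharacter (χ : Monics F → ℂ) : Prop :=
  ∃ (ℓ : ℕ) (H : F[X]), H ≠ 0 ∧
    ∃ ψ : (hayesCon ℓ H).Quotientˣ →* ℂˣ, χ = hayesExtend ℓ H ψ

/-! ### Arithmetic functions on monic polynomials -/

variable [Fintype F]

/-- The norm `|f| = q ^ deg f`, where `q` is the cardinality of `F`. -/
def polyNorm (f : Monics F) : ℝ :=
  (Fintype.card F : ℝ) ^ (f : F[X]).natDegree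

/-- The probability that a uniform random matrix in `GL(n, F)`, `n = deg f`, has
characteristic polynomial `f`. (For `n = 0` the only matrix is the empty one, and its
characteristic polynomial is `1`, so the value at `f = 1` is `1`.) -/
def PGL (f : Monics F) : ℝ :=
  (Nat.card {M : Matrix.GeneralLinearGroup (Fin (f : F[X]).natDegree) F //
      (M : Matrix (Fin (f : F[X]).natDegree) (Fin (f : F[X]).natDegree) F).charpoly = f} : ℝ) /
    Nat.card (Matrix.GeneralLinearGroup (Fin (f : F[X]).natDegree) F)

open scoped Classical in
/-- `α_i(g) = |g|⁻ⁱ` if `g` is coprime to `T`, and `0` otherwise. -/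
def alphaGL (i : ℕ) (g : Monics F) : ℝ :=
  if IsCoprime (g : F[X]) X then 1 / polyNorm g ^ i else 0

theorem finite_factorizations (f : Monics F) :
    {p : Monics F × Monics F | p.1 * p.2 = f}.Finite := by
  have hfin : {g : Monics F | (g : F[X]).natDegree ≤ (f : F[X]).natDegree}.Finite := by
    have h1 : Finite (degreeLT F ((f : F[X]).natDegree + 1)) := Module.finite_of_finite F
    have h2 : ((degreeLT F ((f : F[X]).natDegree + 1) : Submodule F F[X]) : Set F[X]).Finite :=
      Set.toFinite _
    refine (h2.preimage Subtype.val_injective.injOn).subset fun g hg => ?_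
    simp only [Set.mem_preimage, SetLike.mem_coe, mem_degreeLT]
    exact lt_of_le_of_lt degree_le_natDegree (by exact_mod_cast Nat.lt_succ_of_le hg)
  refine (hfin.prod hfin).subset ?_
  rintro ⟨a, b⟩ (h : a * b = f)
  have hd : (f : F[X]).natDegree = (a : F[X]).natDegree + (b : F[X]).natDegree := by
    rw [← h, Submonoid.coe_mul]
    exact Monic.natDegree_mul a.2 b.2
  refine ⟨?_, ?_⟩ <;> simp only [Set.mem_ofPred_eq] <;> omega

/-- Dirichlet convolution: `(α * β)(f) = ∑ α(d) β(δ)` over pairs of monic `d, δ` with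
`d δ = f`. -/
def dirichletConv (α β : Monics F → ℝ) (f : Monics F) : ℝ :=
  ∑ p ∈ (finite_factorizations f).toFinset, α p.1 * β p.2

open scoped Classical in
/-- The `k`-fold Dirichlet convolution `α_1 * α_2 * ⋯ * α_k`; for `k = 0` it is the identity of
Dirichlet convolution, the indicator function of `{1}`. -/
def convUpTo (α : ℕ → Monics F → ℝ) : ℕ → Monics F → ℝ
  | 0 => fun f => if f = 1 then 1 else 0
  | k + 1 => dirichletConv (convUpTo α k) (α (k + 1))

/-- `L_GL(u, χ) = ∑ χ(f) u ^ deg f` over monic `f` coprime to `T`. -/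
def LGL (u : ℂ) (χ : Monics F → ℂ) : ℂ :=
  ∑' f : {f : Monics F // IsCoprime (f : F[X]) X}, χ f * u ^ ((f : Monics F) : F[X]).natDegree

end GLCharpoly

end

noncomputable section

/-! Both `PGL` and the convolutions A_k = α_1 * ⋯ * α_k obey one linear recursion. For `PGL`, count
pairs (M, v) with M of characteristic polynomial f, n = deg f, and v any vector. The monic
annihilator d of v divides f, say f = dδ. In a basis beginning with the iterates of v, M is block
triangular, with a fixed cyclic block for d, an arbitrary corner, and a quotient block of
characteristic polynomial δ. Summing over d gives |f| P(f) = ∑_{dδ=f} P(δ) for f coprime to T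
(`polyNorm_mul_PGL`).

Dividing by the norm commutes with convolution and turns α_i into α_{i+1}, so |f| A_{k+1}(f) =
∑_{dδ=f} A_k(δ) for the same f. Since A_0 ≤ P, all A_k ≤ P; they increase with k, and their limit
solves the recursion of P. The term d = 1 has coefficient 1 ≠ |f|, so the value at 1 determines the
solution (`eq_of_functional_equation`).

For the second part, multiplicativity of χ turns the partial products of L-values into the
generating series of A_k. Each is dominated by ∑ P(f)|u|^{deg f}, which converges because P sums to
1 in each degree. Dominated convergence concludes. -/

namespace GLCharpoly

/-! ### Cyclic vectors and block-triangular form -/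

/-- `d` generates the annihilator of the vector `v` under the action of `F[X]` defined by `M`. -/
def IsAnnihilator {F : Type*} [Field F] {ι : Type*} [Fintype ι] [DecidableEq ι]
    (M : Matrix ι ι F) (v : ι → F) (d : F[X]) : Prop :=
  ∀ p : F[X], (aeval M p).mulVec v = 0 ↔ d ∣ p

/-- The action on a vector depends only on the residue modulo `d`, so vectors with equal
annihilators satisfy the same relations. -/
theorem IsAnnihilator.aeval_congr {F : Type*} [Field F] {ι κ : Type*} [Fintype ι] [DecidableEq ι]
    [Fintype κ] [DecidableEq κ] {M : Matrix ι ι F} {v : ι → F} {N : Matrix κ κ F} {w : κ → F}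
    {d : F[X]} (hM : IsAnnihilator M v d) (hN : IsAnnihilator N w d) {p r : F[X]}
    (h : (aeval M p).mulVec v = (aeval M r).mulVec v) :
    (aeval N p).mulVec w = (aeval N r).mulVec w := by
  rw [← sub_eq_zero, ← Matrix.sub_mulVec, ← map_sub] at h ⊢
  exact (hN _).2 ((hM _).1 h)

/-- Every monic polynomial is the annihilator of a cyclic vector, whose iterates form the standard
basis. -/
theorem exists_cyclic_model {F : Type*} [Field F] {d : F[X]} (hd : d.Monic) :
    ∃ (C : Matrix (Fin d.natDegree) (Fin d.natDegree) F) (w : Fin d.natDegree → F),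
      IsAnnihilator C w d ∧ (∀ i : Fin d.natDegree, (C ^ (i : ℕ)).mulVec w = Pi.single i 1) ∧
      C.charpoly = d := by
  -- The model is multiplication by the root on F[X]/(d), in the power basis, with cyclic vector 1.
  let b : Module.Basis (Fin d.natDegree) F (AdjoinRoot d) := (AdjoinRoot.powerBasis' hd).basis
  have hb : ∀ i, b i = AdjoinRoot.root d ^ (i : ℕ) := fun i =>
    (AdjoinRoot.powerBasis' hd).basis_eq_pow i
  let C := Algebra.leftMulMatrix b (AdjoinRoot.root d)
  have key : ∀ p : F[X], (aeval C p).mulVec (b.repr 1) = b.repr (AdjoinRoot.mk d p) := fun p => by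
    have h1 : aeval C p = Algebra.leftMulMatrix b (AdjoinRoot.mk d p) := by
      rw [← AdjoinRoot.aeval_eq]
      exact aeval_algHom_apply _ _ _
    rw [h1, Algebra.leftMulMatrix_mulVec_repr, mul_one]
  have hann : IsAnnihilator C (b.repr 1) d := fun p => by
    rw [key, Finsupp.coe_eq_zero, LinearEquiv.map_eq_zero_iff, AdjoinRoot.mk_eq_zero]
  refine ⟨C, b.repr 1, hann, fun i => ?_, ?_⟩
  · have := key (X ^ (i : ℕ))
    rw [map_pow, aeval_X, map_pow, AdjoinRoot.mk_X, ← hb, b.repr_self] at this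
    rw [this, Finsupp.single_eq_pi_single]
  · refine (eq_of_monic_of_dvd_of_natDegree_le hd C.charpoly_monic ((hann _).1 ?_) ?_)
    · rw [Matrix.aeval_self_charpoly, Matrix.zero_mulVec]
    · simp [Matrix.charpoly_natDegree_eq_dim]

/-- The iterates of a vector below the degree of its annihilator extend to a basis. -/
theorem exists_GL_mulVec_eq_iterate {F : Type*} [Field F] {k m : ℕ}
    {M : Matrix (Fin k ⊕ Fin m) (Fin k ⊕ Fin m) F} {v : Fin k ⊕ Fin m → F} {d : F[X]}
    (hd : d.Monic) (hk : d.natDegree = k) (h : IsAnnihilator M v d) :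
    ∃ g : Matrix.GeneralLinearGroup (Fin k ⊕ Fin m) F, ∀ i : Fin k,
      g.val.mulVec (Pi.single (Sum.inl i) 1) = (M ^ (i : ℕ)).mulVec v := by
  have hli : LinearIndependent F (fun i : Fin k => (M ^ (i : ℕ)).mulVec v) := by
    rw [Fintype.linearIndependent_iff]
    intro a ha
    -- A linear relation is a polynomial of degree below k that kills v, hence a multiple of `d`,
    -- hence zero.
    have h0 : (∑ i : Fin k, C (a i) * X ^ (i : ℕ)) = 0 := by
      refine eq_zero_of_dvd_of_degree_lt ((h _).1 ?_) ?_
      · rw [← ha, map_sum, Matrix.sum_mulVec]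
        refine Finset.sum_congr rfl fun i _ => ?_
        rw [← smul_eq_C_mul, map_smul, map_pow, aeval_X, Matrix.smul_mulVec]
      · rw [degree_eq_natDegree hd.ne_zero, hk]
        refine lt_of_le_of_lt (degree_sum_le _ _) ((Finset.sup_lt_iff (WithBot.bot_lt_coe k)).2 ?_)
        intro i _
        exact lt_of_le_of_lt (degree_C_mul_X_pow_le _ _) (Nat.cast_lt.2 i.2)
    intro i
    have h1 := congrArg (fun p => p.coeff (i : ℕ)) h0
    simpa [finsetSum_coeff, coeff_C_mul, coeff_X_pow, Fin.val_inj] using h1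
  let b := Module.Basis.sumExtend hli
  have hbl : ∀ i, b (Sum.inl i) = (M ^ (i : ℕ)).mulVec v := fun i => by
    simp only [b, Module.Basis.sumExtend, Equiv.trans_def, Module.Basis.reindex_apply,
      Module.Basis.extend_apply_self]
    rfl
  have hfin : Finite (Module.Basis.sumExtendIndex hli) := by
    have := Module.Finite.finite_basis b
    exact Finite.of_injective (Sum.inr : _ → Fin k ⊕ Module.Basis.sumExtendIndex hli)
      Sum.inr_injective
  have hcard : Nat.card (Module.Basis.sumExtendIndex hli) = m := by
    have h1 := Module.finrank_eq_nat_card_basis b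
    rw [Module.finrank_fintype_fun_eq_card, Nat.card_sum] at h1
    simpa using h1.symm
  let e := (Equiv.refl (Fin k)).sumCongr (Finite.equivFinOfCardEq hcard)
  let b' := b.reindex e
  have hu : IsUnit ((Pi.basisFun F (Fin k ⊕ Fin m)).toMatrix b') :=
    @isUnit_of_invertible _ _ _ ((Pi.basisFun F (Fin k ⊕ Fin m)).invertibleToMatrix b')
  refine ⟨hu.unit, fun i => ?_⟩
  rw [← hbl, IsUnit.unit_spec, Matrix.mulVec_single_one]
  ext j
  simp [Module.Basis.toMatrix_apply, b', e, Matrix.col]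

theorem mulVec_elim_zero_fromBlocks {F : Type*} [Field F] {κ μ : Type*} [Fintype κ] [Fintype μ]
    [DecidableEq κ] [DecidableEq μ]
    (C : Matrix κ κ F) (B : Matrix κ μ F) (N : Matrix μ μ F) (w : κ → F) (p : F[X]) :
    (aeval (Matrix.fromBlocks C B 0 N) p).mulVec (Sum.elim w 0) =
      Sum.elim ((aeval C p).mulVec w) 0 := by
  induction p using Polynomial.induction_on' with
  | add p r hp hr =>
    rw [map_add, Matrix.add_mulVec, hp, hr, map_add, Matrix.add_mulVec]
    ext (i | i) <;> simp
  | monomial j a =>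
    rw [aeval_monomial, aeval_monomial, ← Algebra.smul_def, ← Algebra.smul_def,
      Matrix.smul_mulVec, Matrix.smul_mulVec]
    have : ∀ j : ℕ, (Matrix.fromBlocks C B 0 N ^ j).mulVec (Sum.elim w 0) =
        Sum.elim ((C ^ j).mulVec w) 0 := fun j => by
      induction j with
      | zero => simp
      | succ j ih =>
        rw [pow_succ', ← Matrix.mulVec_mulVec, ih, Matrix.fromBlocks_mulVec, pow_succ',
          ← Matrix.mulVec_mulVec]
        simp
    rw [this]
    ext (i | i) <;> simp

/-- The invertible matrices with prescribed first columns, one such matrix being given. -/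
theorem card_GL_prescribed_columns {F : Type*} [Field F] {κ μ : Type*} [Fintype κ] [Fintype μ]
    [DecidableEq κ] [DecidableEq μ] (x : κ → κ ⊕ μ → F) (g₀ : Matrix.GeneralLinearGroup (κ ⊕ μ) F)
    (h₀ : ∀ i, g₀.val.mulVec (Pi.single (Sum.inl i) 1) = x i) :
    Nat.card {g : Matrix.GeneralLinearGroup (κ ⊕ μ) F //
        ∀ i, g.val.mulVec (Pi.single (Sum.inl i) 1) = x i} =
      Nat.card (Matrix κ μ F) * Nat.card (Matrix.GeneralLinearGroup μ F) := by
  rw [← Nat.card_prod]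
  symm
  have hdet : ∀ t : Matrix κ μ F × Matrix.GeneralLinearGroup μ F,
      (Matrix.fromBlocks 1 t.1 0 (t.2 : Matrix μ μ F)).det ≠ 0 := fun t => by
    rw [Matrix.det_fromBlocks_zero₂₁, Matrix.det_one, one_mul]
    exact ((Matrix.isUnit_iff_isUnit_det _).1 t.2.isUnit).ne_zero
  -- Two solutions differ on the right by a matrix fixing the first basis vectors, that is, by a
  -- block matrix [1, B; 0, N] with N invertible.
  refine Nat.card_eq_of_bijective (fun t => ⟨g₀ * Matrix.GeneralLinearGroup.mkOfDetNeZero _ (hdet t),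
    fun i => ?_⟩) ⟨fun s t hst => ?_, fun g => ?_⟩
  · rw [← h₀, Units.val_mul, ← Matrix.mulVec_mulVec]
    congr 1
    simp only [Matrix.GeneralLinearGroup.mkOfDetNeZero, Matrix.mulVec_single_one]
    ext (j | j)
    · simp [Matrix.col, Matrix.one_apply, Pi.single_apply]
    · simp [Matrix.col]
  · have h1 := congrArg Units.val (mul_left_cancel (congrArg Subtype.val hst))
    have h2 := Matrix.fromBlocks_inj.1 (show Matrix.fromBlocks _ _ _ _ = Matrix.fromBlocks _ _ _ _ from h1)
    exact Prod.ext h2.2.1 (Units.ext h2.2.2.2)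
  · let h : Matrix.GeneralLinearGroup (κ ⊕ μ) F := g₀⁻¹ * g.1
    have hcol : ∀ i, h.val.mulVec (Pi.single (Sum.inl i) 1) = Pi.single (Sum.inl i) 1 :=
      fun i => by
        rw [Units.val_mul, ← Matrix.mulVec_mulVec, g.2, ← h₀, Matrix.mulVec_mulVec, ← Units.val_mul,
          inv_mul_cancel, Units.val_one, Matrix.one_mulVec]
    have hent : ∀ j i, h.val j (Sum.inl i) = (Pi.single (Sum.inl i) 1 : κ ⊕ μ → F) j :=
      fun j i => by
        rw [← hcol, Matrix.mulVec_single_one]; rfl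
    have hblock : h.val =
        Matrix.fromBlocks 1 h.val.toBlocks₁₂ 0 h.val.toBlocks₂₂ := by
      ext (j | j) (i | i)
      · simp [hent, Matrix.one_apply, Pi.single_apply]
      · rfl
      · simp [hent]
      · rfl
    have hd : h.val.toBlocks₂₂.det ≠ 0 := by
      have h1 := ((Matrix.isUnit_iff_isUnit_det _).1 h.isUnit).ne_zero
      rwa [hblock, Matrix.det_fromBlocks_zero₂₁, Matrix.det_one, one_mul] at h1
    refine ⟨(h.val.toBlocks₁₂, Matrix.GeneralLinearGroup.mkOfDetNeZero _ hd), Subtype.ext ?_⟩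
    show g₀ * _ = g.1
    rw [← eq_inv_mul_iff_mul_eq]
    exact Units.ext hblock.symm

/-! ### Counting matrix–vector pairs by annihilator -/

/-- The number of square matrices indexed by `ι` with characteristic polynomial `f`. -/
def charpolyCount {F : Type*} [Field F] (ι : Type*) [Fintype ι] [DecidableEq ι] (f : F[X]) : ℕ :=
  Nat.card {M : Matrix ι ι F // M.charpoly = f}

/-- The number of pairs of a matrix with characteristic polynomial `f` and a vector whose
annihilator is generated by `d`. -/
def annihilatorCount {F : Type*} [Field F] (ι : Type*) [Fintype ι] [DecidableEq ι] (f d : F[X]) :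
    ℕ :=
  Nat.card {t : Matrix ι ι F × (ι → F) // t.1.charpoly = f ∧ IsAnnihilator t.1 t.2 d}

theorem annihilatorCount_congr {F : Type*} [Field F] {ι κ : Type*} [Fintype ι] [DecidableEq ι]
    [Fintype κ] [DecidableEq κ] (e : ι ≃ κ) (f d : F[X]) :
    annihilatorCount ι f d = annihilatorCount κ f d := by
  refine Nat.card_congr (Equiv.subtypeEquiv
    ((Matrix.reindexAlgEquiv F F e).toEquiv.prodCongr (e.arrowCongr (Equiv.refl F))) fun t => ?_)
  have h1 : ((Matrix.reindexAlgEquiv F F e) t.1).charpoly = t.1.charpoly :=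
    Matrix.charpoly_reindex e t.1
  have h2 : ∀ p : F[X], (aeval (Matrix.reindexAlgEquiv F F e t.1) p).mulVec (t.2 ∘ e.symm) =
      ((aeval t.1 p).mulVec t.2) ∘ e.symm := fun p => by
    have : aeval (Matrix.reindexAlgEquiv F F e t.1) p =
        Matrix.reindexAlgEquiv F F e (aeval t.1 p) := aeval_algHom_apply
          (Matrix.reindexAlgEquiv F F e).toAlgHom t.1 p
    rw [this, Matrix.coe_reindexAlgEquiv, Matrix.reindex_apply, Matrix.submatrix_mulVec_equiv]
    simp [Function.comp_assoc]
  have h3 : ∀ x : ι → F, x ∘ e.symm = 0 ↔ x = 0 := fun x =>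
    ⟨fun h => funext fun i => by simpa using congrFun h (e i), fun h => by rw [h]; rfl⟩
  show _ ↔ ((Matrix.reindexAlgEquiv F F e) t.1).charpoly = f ∧
    IsAnnihilator (Matrix.reindexAlgEquiv F F e t.1) (t.2 ∘ e.symm) d
  rw [h1]
  refine and_congr Iff.rfl (forall_congr' fun p => ?_)
  rw [h2, h3]

theorem card_GL_congr {F : Type*} [Field F] {ι κ : Type*} [Fintype ι] [DecidableEq ι]
    [Fintype κ] [DecidableEq κ] (e : ι ≃ κ) :
    Nat.card (Matrix.GeneralLinearGroup ι F) = Nat.card (Matrix.GeneralLinearGroup κ F) :=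
  Nat.card_congr (Units.mapEquiv (Matrix.reindexAlgEquiv F F e).toMulEquiv).toEquiv

theorem aeval_sum_smul_X_pow_mulVec {F : Type*} [Field F] {ι : Type*} [Fintype ι] [DecidableEq ι]
    {k : ℕ} (N : Matrix ι ι F) (x : ι → F) (a : Fin k → F) :
    (aeval N (∑ i : Fin k, a i • X ^ (i : ℕ) : F[X])).mulVec x =
      ∑ i : Fin k, a i • (N ^ (i : ℕ)).mulVec x := by
  rw [map_sum, Matrix.sum_mulVec]
  exact Finset.sum_congr rfl fun i _ => by rw [map_smul, map_pow, aeval_X, Matrix.smul_mulVec]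

/-- The coordinates of p(C)w are the coefficients of a polynomial of degree below k acting on w as p
does; by the common annihilator it also acts as p on v. Hence `g` intertwines the two cyclic
subspaces. -/
theorem mulVec_eq_of_isAnnihilator {F : Type*} [Field F] {k : ℕ} {μ : Type*} [Fintype μ]
    [DecidableEq μ] {C : Matrix (Fin k) (Fin k) F} {w : Fin k → F} {d : F[X]}
    (hC : IsAnnihilator C w d) (hw : ∀ i : Fin k, (C ^ (i : ℕ)).mulVec w = Pi.single i 1)
    {M : Matrix (Fin k ⊕ μ) (Fin k ⊕ μ) F} {v : Fin k ⊕ μ → F} (hM : IsAnnihilator M v d)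
    {g : Matrix (Fin k ⊕ μ) (Fin k ⊕ μ) F}
    (hg : ∀ i : Fin k, g.mulVec (Pi.single (Sum.inl i) 1) = (M ^ (i : ℕ)).mulVec v) (p : F[X]) :
    g.mulVec (Sum.elim ((aeval C p).mulVec w) 0) = (aeval M p).mulVec v := by
  set a := (aeval C p).mulVec w with ha
  have h1 : (aeval C p).mulVec w = (aeval C (∑ i : Fin k, a i • X ^ (i : ℕ) : F[X])).mulVec w := by
    rw [← ha, aeval_sum_smul_X_pow_mulVec]
    simp only [hw]
    exact pi_eq_sum_univ' a
  rw [hC.aeval_congr hM h1, aeval_sum_smul_X_pow_mulVec]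
  simp only [← hg, ← Matrix.mulVec_smul, ← Matrix.mulVec_sum]
  congr 1
  ext (i | i)
  · simp [Finset.sum_apply, Pi.single_apply]
  · simp [Finset.sum_apply]

theorem isAnnihilator_conj_fromBlocks {F : Type*} [Field F] {κ μ : Type*} [Fintype κ] [Fintype μ]
    [DecidableEq κ] [DecidableEq μ] (C : Matrix κ κ F) (B : Matrix κ μ F) (N : Matrix μ μ F)
    (w : κ → F) (g : Matrix.GeneralLinearGroup (κ ⊕ μ) F) (p : F[X]) :
    (aeval (g.val * Matrix.fromBlocks C B 0 N * g⁻¹.val) p).mulVec (g.val.mulVec (Sum.elim w 0)) =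
      g.val.mulVec (Sum.elim ((aeval C p).mulVec w) 0) := by
  have h : aeval (g.val * Matrix.fromBlocks C B 0 N * g⁻¹.val) p =
      g.val * aeval (Matrix.fromBlocks C B 0 N) p * g⁻¹.val := by
    -- Conjugation by g is an algebra automorphism, so it commutes with polynomial evaluation.
    have := aeval_algHom_apply
      (MulSemiringAction.toAlgEquiv F (Matrix (κ ⊕ μ) (κ ⊕ μ) F) (ConjAct.toConjAct g)).toAlgHom
      (Matrix.fromBlocks C B 0 N) p
    exact this
  rw [h, Matrix.mulVec_mulVec, mul_assoc, ← Units.val_mul, inv_mul_cancel, Units.val_one, mul_one,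
    ← Matrix.mulVec_mulVec, mulVec_elim_zero_fromBlocks]

/-- Double count of triples (M, v, g) where the first k columns of g are v, Mv, …, M^{k-1}v. Fixing
(M, v) counts completions to a basis; fixing g leaves the blocks B and N of g⁻¹Mg = [C, B; 0, N].
The factor for B occurs on both sides and cancels. -/
theorem annihilatorCount_mul_card_GL_sum {F : Type*} [Field F] [Fintype F] {k m : ℕ} {d δ : F[X]}
    (hd : d.Monic) (hk : d.natDegree = k) :
    annihilatorCount (Fin k ⊕ Fin m) (d * δ) d * Nat.card (Matrix.GeneralLinearGroup (Fin m) F) =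
      Nat.card (Matrix.GeneralLinearGroup (Fin k ⊕ Fin m) F) * charpolyCount (Fin m) δ := by
  obtain ⟨C, w, hC, hw, hCd⟩ : ∃ (C : Matrix (Fin k) (Fin k) F) (w : Fin k → F),
      IsAnnihilator C w d ∧ (∀ i : Fin k, (C ^ (i : ℕ)).mulVec w = Pi.single i 1) ∧
      C.charpoly = d := by
    subst hk
    exact exists_cyclic_model hd
  let S := {t : Matrix (Fin k ⊕ Fin m) (Fin k ⊕ Fin m) F × (Fin k ⊕ Fin m → F) //
    t.1.charpoly = d * δ ∧ IsAnnihilator t.1 t.2 d}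
  let T := Σ t : S, {g : Matrix.GeneralLinearGroup (Fin k ⊕ Fin m) F //
    ∀ i : Fin k, g.val.mulVec (Pi.single (Sum.inl i) 1) = (t.1.1 ^ (i : ℕ)).mulVec t.1.2}
  have : Fintype S := Fintype.ofFinite S
  have hT1 : Nat.card T = annihilatorCount (Fin k ⊕ Fin m) (d * δ) d *
      (Nat.card (Matrix (Fin k) (Fin m) F) * Nat.card (Matrix.GeneralLinearGroup (Fin m) F)) := by
    have hfib : ∀ t : S, Nat.card {g : Matrix.GeneralLinearGroup (Fin k ⊕ Fin m) F //
        ∀ i : Fin k, g.val.mulVec (Pi.single (Sum.inl i) 1) = (t.1.1 ^ (i : ℕ)).mulVec t.1.2} =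
        Nat.card (Matrix (Fin k) (Fin m) F) * Nat.card (Matrix.GeneralLinearGroup (Fin m) F) := by
      intro t
      obtain ⟨g₀, h₀⟩ := exists_GL_mulVec_eq_iterate hd hk t.2.2
      exact card_GL_prescribed_columns _ g₀ h₀
    rw [Nat.card_sigma, Finset.sum_congr rfl (fun t _ => hfib t), Finset.sum_const,
      Finset.card_univ, ← Nat.card_eq_fintype_card, smul_eq_mul]
    rfl
  have hT2 : Nat.card T = Nat.card (Matrix.GeneralLinearGroup (Fin k ⊕ Fin m) F) *
      (Nat.card (Matrix (Fin k) (Fin m) F) * charpolyCount (Fin m) δ) := by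
    rw [charpolyCount, ← Nat.card_prod, ← Nat.card_prod]
    have hcp : ∀ (g : Matrix.GeneralLinearGroup (Fin k ⊕ Fin m) F) B (N : Matrix (Fin m) (Fin m) F),
        (g.val * Matrix.fromBlocks C B 0 N * g⁻¹.val).charpoly = d * N.charpoly := fun g B N => by
      rw [Matrix.coe_units_inv, Matrix.charpoly_units_conj, Matrix.charpoly_fromBlocks_zero₂₁, hCd]
    have hinj : ∀ {a : Fin k → F} (g : Matrix.GeneralLinearGroup (Fin k ⊕ Fin m) F),
        g.val.mulVec (Sum.elim a 0) = 0 ↔ a = 0 := fun {a} g => by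
      rw [← Matrix.mulVec_zero g.val, (Matrix.mulVec_injective_of_isUnit g.isUnit).eq_iff]
      exact ⟨fun h => funext fun i => congrFun h (Sum.inl i), fun h => by ext (i | i) <;> simp [h]⟩
    symm
    refine Nat.card_eq_of_bijective (fun t => ⟨⟨(t.1.val * Matrix.fromBlocks C t.2.1 0 t.2.2.1 *
      t.1⁻¹.val, t.1.val.mulVec (Sum.elim w 0)), by rw [hcp, t.2.2.2], fun p => by
        rw [isAnnihilator_conj_fromBlocks, hinj, hC]⟩, t.1, fun i => ?_⟩)
      ⟨fun s t hst => ?_, fun t => ?_⟩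
    · have := isAnnihilator_conj_fromBlocks C t.2.1 t.2.2.1 w t.1 (X ^ (i : ℕ))
      rw [map_pow, map_pow, aeval_X, aeval_X, hw] at this
      rw [this]
      congr 1
      ext (j | j) <;> simp [Pi.single_apply]
    · have hg : s.1 = t.1 := congrArg (fun z : T => z.2.1) hst
      have hM : s.1.val * Matrix.fromBlocks C s.2.1 0 s.2.2.1 * s.1⁻¹.val =
          t.1.val * Matrix.fromBlocks C t.2.1 0 t.2.2.1 * t.1⁻¹.val :=
        congrArg (fun z : T => z.1.1.1) hst
      rw [hg, Units.mul_left_inj, Units.mul_right_inj, Matrix.fromBlocks_inj] at hM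
      exact Prod.ext hg (Prod.ext hM.2.1 (Subtype.ext hM.2.2.2))
    · obtain ⟨⟨⟨M, v⟩, h1, h2⟩, g, hg⟩ := t
      have hact := mulVec_eq_of_isAnnihilator hC hw h2 hg
      have hv : g.val.mulVec (Sum.elim w 0) = v := by simpa using hact 1
      -- Taking p = X^{i+1} includes the last column, where M^k v lies beyond the basis vectors and
      -- must be reduced modulo `d`.
      have hent : ∀ j i, (g⁻¹.val * M * g.val) j (Sum.inl i) =
          (Sum.elim (C.mulVec (Pi.single i 1)) 0 : Fin k ⊕ Fin m → F) j := fun j i => by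
        have h3 := hact (X ^ ((i : ℕ) + 1))
        rw [map_pow, map_pow, aeval_X, aeval_X, pow_succ', pow_succ', ← Matrix.mulVec_mulVec,
          ← Matrix.mulVec_mulVec, hw, ← hg] at h3
        have h4 : (g⁻¹.val * M * g.val).mulVec (Pi.single (Sum.inl i) 1) =
            Sum.elim (C.mulVec (Pi.single i 1)) 0 := by
          rw [← Matrix.mulVec_mulVec, ← Matrix.mulVec_mulVec, ← h3, Matrix.mulVec_mulVec,
            ← Units.val_mul, inv_mul_cancel, Units.val_one, Matrix.one_mulVec]
        rw [← h4, Matrix.mulVec_single_one]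
        rfl
      obtain ⟨B, N, hM⟩ : ∃ B N, g.val * Matrix.fromBlocks C B 0 N * g⁻¹.val = M := by
        refine ⟨(g⁻¹.val * M * g.val).toBlocks₁₂, (g⁻¹.val * M * g.val).toBlocks₂₂, ?_⟩
        have : Matrix.fromBlocks C (g⁻¹.val * M * g.val).toBlocks₁₂ 0
            (g⁻¹.val * M * g.val).toBlocks₂₂ = g⁻¹.val * M * g.val := by
          ext (j | j) (i | i)
          · rw [hent]; simp [Matrix.col]
          · rfl
          · rw [hent]; simp
          · rfl
        rw [this, ← mul_assoc, ← mul_assoc, ← Units.val_mul, mul_inv_cancel, Units.val_one, one_mul,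
          mul_assoc, ← Units.val_mul, mul_inv_cancel, Units.val_one, mul_one]
      subst hM hv
      have hN : N.charpoly = δ := by
        rw [hcp] at h1
        exact mul_left_cancel₀ hd.ne_zero h1
      exact ⟨(g, B, ⟨N, hN⟩), rfl⟩
  have hpos : 0 < Nat.card (Matrix (Fin k) (Fin m) F) := Nat.card_pos
  refine Nat.eq_of_mul_eq_mul_left hpos ?_
  linarith [hT1.symm.trans hT2]

/-- The polynomials killing v form an ideal of a PID, nonzero by Cayley–Hamilton. -/
theorem exists_monic_isAnnihilator {F : Type*} [Field F] {ι : Type*} [Fintype ι] [DecidableEq ι]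
    (M : Matrix ι ι F) (v : ι → F) : ∃ d : F[X], d.Monic ∧ IsAnnihilator M v d := by
  classical
  let I : Ideal F[X] :=
    { carrier := {p | (aeval M p).mulVec v = 0}
      add_mem' := fun {a b} (ha : _ = _) (hb : _ = _) => by
        show (aeval M (a + b)).mulVec v = 0
        rw [map_add, Matrix.add_mulVec, ha, hb, add_zero]
      zero_mem' := by simp
      smul_mem' := fun c a (ha : _ = _) => by
        show (aeval M (c * a)).mulVec v = 0
        rw [map_mul, ← Matrix.mulVec_mulVec, ha, Matrix.mulVec_zero] }
  have hI : ∀ p, p ∈ I ↔ (aeval M p).mulVec v = 0 := fun p => Iff.rfl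
  obtain ⟨x, hx⟩ := (IsPrincipalIdealRing.principal I).principal
  have hx0 : x ≠ 0 := by
    rintro rfl
    have h1 : M.charpoly ∈ I := by rw [hI, Matrix.aeval_self_charpoly, Matrix.zero_mulVec]
    rw [hx, Submodule.span_zero_singleton] at h1
    exact M.charpoly_monic.ne_zero h1
  refine ⟨normalize x, monic_normalize hx0, fun p => ?_⟩
  rw [← hI, hx, normalize_dvd_iff]
  exact Ideal.mem_span_singleton

/-- Every vector has exactly one monic annihilator, and it divides f by Cayley–Hamilton; thus the
pairs (M, v) are partitioned by factorizations of f. -/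
theorem card_pow_mul_charpolyCount {F : Type*} [Field F] [Fintype F] (n : ℕ) (f : Monics F) :
    Fintype.card F ^ n * charpolyCount (Fin n) (f : F[X]) =
      ∑ p ∈ (finite_factorizations f).toFinset, annihilatorCount (Fin n) (f : F[X]) (p.1 : F[X]) := by
  have hL : Fintype.card F ^ n * charpolyCount (Fin n) (f : F[X]) =
      Nat.card ({M : Matrix (Fin n) (Fin n) F // M.charpoly = f} × (Fin n → F)) := by
    rw [Nat.card_prod, mul_comm, charpolyCount]
    simp
  rw [hL, ← Finset.sum_coe_sort]
  simp only [annihilatorCount]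
  rw [← Nat.card_sigma]
  symm
  refine Nat.card_eq_of_bijective (fun s => (⟨s.2.1.1, s.2.2.1⟩, s.2.1.2)) ⟨fun s t hst => ?_, ?_⟩
  · obtain ⟨⟨⟨d, δ⟩, hp⟩, ⟨M, v⟩, h1, h2⟩ := s
    obtain ⟨⟨⟨d', δ'⟩, hp'⟩, ⟨M', v'⟩, h1', h2'⟩ := t
    obtain rfl : M = M' := congrArg (fun z => z.1.1) hst
    obtain rfl : v = v' := congrArg (fun z => z.2) hst
    have hd : (d : F[X]) = d' := eq_of_monic_of_associated d.2 d'.2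
      (associated_of_dvd_dvd ((h2 _).1 ((h2' _).2 dvd_rfl)) ((h2' _).1 ((h2 _).2 dvd_rfl)))
    obtain rfl : d = d' := Subtype.ext hd
    rw [Set.Finite.mem_toFinset] at hp hp'
    obtain rfl : δ = δ' := by
      refine Subtype.ext (mul_left_cancel₀ d.2.ne_zero ?_)
      exact congrArg Subtype.val ((show d * δ = f from hp).trans (show d * δ' = f from hp').symm)
    rfl
  · rintro ⟨⟨M, hM⟩, v⟩
    obtain ⟨d, hd, h⟩ := exists_monic_isAnnihilator M v
    obtain ⟨δ, hδ⟩ : d ∣ (f : F[X]) := by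
      rw [← hM, ← h, Matrix.aeval_self_charpoly, Matrix.zero_mulVec]
    have hδm : δ.Monic := hd.of_mul_monic_left (hδ ▸ f.2)
    refine ⟨⟨⟨(⟨d, hd⟩, ⟨δ, hδm⟩), ?_⟩, (M, v), hM, h⟩, rfl⟩
    rw [Set.Finite.mem_toFinset]
    exact Subtype.ext hδ.symm

theorem natDegree_add_of_mul_eq {F : Type*} [Field F] {d δ f : Monics F} (h : d * δ = f) :
    (d : F[X]).natDegree + (δ : F[X]).natDegree = (f : F[X]).natDegree := by
  rw [← h, Submonoid.coe_mul]
  exact (Monic.natDegree_mul d.2 δ.2).symm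

theorem annihilatorCount_mul_card_GL {F : Type*} [Field F] [Fintype F] {d δ f : Monics F}
    (h : d * δ = f) :
    annihilatorCount (Fin (f : F[X]).natDegree) (f : F[X]) (d : F[X]) *
        Nat.card (Matrix.GeneralLinearGroup (Fin (δ : F[X]).natDegree) F) =
      Nat.card (Matrix.GeneralLinearGroup (Fin (f : F[X]).natDegree) F) *
        charpolyCount (Fin (δ : F[X]).natDegree) (δ : F[X]) := by
  have e : Fin (f : F[X]).natDegree ≃ Fin (d : F[X]).natDegree ⊕ Fin (δ : F[X]).natDegree :=
    (finCongr (natDegree_add_of_mul_eq h).symm).trans finSumFinEquiv.symm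
  rw [annihilatorCount_congr e, card_GL_congr e]
  have : (f : F[X]) = d * δ := by rw [← h]; rfl
  rw [this]
  exact annihilatorCount_mul_card_GL_sum d.2 rfl

/-! ### Invertibility and the functional equation of `PGL` -/

theorem isCoprime_X_iff_coeff_zero {F : Type*} [Field F] (f : F[X]) :
    IsCoprime f X ↔ f.coeff 0 ≠ 0 := by
  rw [isCoprime_comm, (irreducible_X).coprime_iff_not_dvd, X_dvd_iff]

theorem isUnit_iff_charpoly_isCoprime_X {F : Type*} [Field F] {ι : Type*} [Fintype ι]
    [DecidableEq ι] (M : Matrix ι ι F) : IsUnit M ↔ IsCoprime M.charpoly X := by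
  rw [isCoprime_X_iff_coeff_zero, Matrix.isUnit_iff_isUnit_det, Matrix.det_eq_sign_charpoly_coeff,
    isUnit_iff_ne_zero]
  simp

/-- Coprimality to X already forces invertibility, so the count may range over all matrices. -/
theorem PGL_of_isCoprime {F : Type*} [Field F] {f : Monics F} (hf : IsCoprime (f : F[X]) X) :
    PGL f = (charpolyCount (Fin (f : F[X]).natDegree) (f : F[X]) : ℝ) /
      Nat.card (Matrix.GeneralLinearGroup (Fin (f : F[X]).natDegree) F) := by
  rw [PGL, charpolyCount]
  congr 2
  refine Nat.card_eq_of_bijective (fun M => ⟨M.1.val, M.2⟩) ⟨fun M N h => ?_, fun M => ?_⟩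
  · exact Subtype.ext (Units.ext (congrArg Subtype.val h))
  · have hu : IsUnit M.1 := (isUnit_iff_charpoly_isCoprime_X _).2 (by rwa [M.2])
    exact ⟨⟨hu.unit, M.2⟩, rfl⟩

theorem PGL_of_not_isCoprime {F : Type*} [Field F] {f : Monics F} (hf : ¬ IsCoprime (f : F[X]) X) : PGL f = 0 := by
  have : IsEmpty {M : Matrix.GeneralLinearGroup (Fin (f : F[X]).natDegree) F //
      (M : Matrix (Fin (f : F[X]).natDegree) (Fin (f : F[X]).natDegree) F).charpoly = f} :=
    ⟨fun M => hf (M.2 ▸ (isUnit_iff_charpoly_isCoprime_X _).1 M.1.isUnit)⟩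
  rw [PGL, Nat.card_of_isEmpty, Nat.cast_zero, zero_div]

theorem isCoprime_X_of_mul_eq {F : Type*} [Field F] {d δ f : Monics F} (h : d * δ = f) :
    IsCoprime (f : F[X]) X ↔ IsCoprime (d : F[X]) X ∧ IsCoprime (δ : F[X]) X := by
  rw [← h, Submonoid.coe_mul, IsCoprime.mul_left_iff]

/-- The functional equation of `PGL`: a pair of a matrix and a vector is determined, up to
extensions, by the annihilator of the vector and the action on the quotient. -/
theorem polyNorm_mul_PGL {F : Type*} [Field F] [Fintype F] {f : Monics F} (hf : IsCoprime (f : F[X]) X) :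
    polyNorm f * PGL f = ∑ p ∈ (finite_factorizations f).toFinset, PGL p.2 := by
  have h1 := card_pow_mul_charpolyCount (f : F[X]).natDegree f
  have hG : ∀ n, (Nat.card (Matrix.GeneralLinearGroup (Fin n) F) : ℝ) ≠ 0 := fun n =>
    Nat.cast_ne_zero.2 Nat.card_pos.ne'
  rw [PGL_of_isCoprime hf, polyNorm, ← mul_div_assoc, div_eq_iff (hG _), Finset.sum_mul]
  have h2 := congrArg (Nat.cast : ℕ → ℝ) h1
  push_cast at h2
  rw [h2]
  refine Finset.sum_congr rfl fun p hp => ?_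
  rw [Set.Finite.mem_toFinset] at hp
  rw [PGL_of_isCoprime ((isCoprime_X_of_mul_eq hp).1 hf).2, div_mul_eq_mul_div, eq_div_iff (hG _)]
  have h3 := congrArg (Nat.cast : ℕ → ℝ) (annihilatorCount_mul_card_GL hp)
  push_cast at h3
  linarith

/-! ### Dirichlet convolution and the limit -/

section Convolution

variable {F : Type*} [Field F] [Fintype F]

theorem mem_factorizations {f : Monics F} {p : Monics F × Monics F} :
    p ∈ (finite_factorizations f).toFinset ↔ p.1 * p.2 = f :=
  Set.Finite.mem_toFinset _

theorem one_mul_mem_factorizations (f : Monics F) :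
    ((1 : Monics F), f) ∈ (finite_factorizations f).toFinset :=
  (mem_factorizations (p := (1, f))).2 (one_mul f)

theorem mul_one_mem_factorizations (f : Monics F) :
    (f, (1 : Monics F)) ∈ (finite_factorizations f).toFinset :=
  (mem_factorizations (p := (f, 1))).2 (mul_one f)

open scoped Classical in
theorem convUpTo_zero_apply (β : ℕ → Monics F → ℝ) (f : Monics F) :
    convUpTo β 0 f = if f = 1 then 1 else 0 := rfl

theorem convUpTo_succ (β : ℕ → Monics F → ℝ) (k : ℕ) :
    convUpTo β (k + 1) = dirichletConv (convUpTo β k) (β (k + 1)) := rfl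

theorem polyNorm_mul (f g : Monics F) : polyNorm (f * g) = polyNorm f * polyNorm g := by
  rw [polyNorm, ← natDegree_add_of_mul_eq rfl, pow_add]
  rfl

theorem polyNorm_pos (f : Monics F) : 0 < polyNorm f :=
  pow_pos (Nat.cast_pos.2 Fintype.card_pos) _

theorem natDegree_pos_of_ne_one {F : Type*} [Field F] {f : Monics F} (hf : f ≠ 1) : 0 < (f : F[X]).natDegree := by
  rw [Nat.pos_iff_ne_zero]
  intro h
  exact hf (Subtype.ext (f.2.natDegree_eq_zero.1 h))

theorem one_lt_polyNorm {f : Monics F} (hf : f ≠ 1) : 1 < polyNorm f :=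
  one_lt_pow₀ (Nat.one_lt_cast.2 Fintype.one_lt_card) (natDegree_pos_of_ne_one hf).ne'

theorem dirichletConv_assoc (α β γ : Monics F → ℝ) :
    dirichletConv (dirichletConv α β) γ = dirichletConv α (dirichletConv β γ) := by
  funext f
  simp only [dirichletConv, Finset.sum_mul, Finset.mul_sum, Finset.sum_sigma']
  refine Finset.sum_nbij' (fun ⟨⟨_, b⟩, ⟨c, d⟩⟩ => ⟨(c, d * b), (d, b)⟩)
    (fun ⟨⟨a, _⟩, ⟨c, d⟩⟩ => ⟨(a * c, d), (a, c)⟩) ?_ ?_ ?_ ?_ ?_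
  · rintro ⟨⟨a, b⟩, ⟨c, d⟩⟩ h
    simp only [Finset.mem_sigma, mem_factorizations] at h ⊢
    exact ⟨by rw [← h.1, ← h.2, mul_assoc], trivial⟩
  · rintro ⟨⟨a, b⟩, ⟨c, d⟩⟩ h
    simp only [Finset.mem_sigma, mem_factorizations] at h ⊢
    exact ⟨by rw [← h.1, ← h.2, mul_assoc], trivial⟩
  · rintro ⟨⟨a, b⟩, ⟨c, d⟩⟩ h
    simp only [Finset.mem_sigma, mem_factorizations] at h
    simp [h.2]
  · rintro ⟨⟨a, b⟩, ⟨c, d⟩⟩ h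
    simp only [Finset.mem_sigma, mem_factorizations] at h
    simp [h.2]
  · rintro ⟨⟨a, b⟩, ⟨c, d⟩⟩ _
    exact mul_assoc _ _ _

theorem dirichletConv_div_polyNorm (α β : Monics F → ℝ) (f : Monics F) :
    dirichletConv (fun g => α g / polyNorm g) (fun g => β g / polyNorm g) f =
      dirichletConv α β f / polyNorm f := by
  simp only [dirichletConv, Finset.sum_div]
  refine Finset.sum_congr rfl fun p hp => ?_
  rw [div_mul_div_comm, ← polyNorm_mul, mem_factorizations.1 hp]

theorem convUpTo_zero_conv (β : ℕ → Monics F → ℝ) (α : Monics F → ℝ) :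
    dirichletConv (convUpTo β 0) α = α := by
  funext f
  rw [dirichletConv, Finset.sum_eq_single (1, f)]
  · simp [convUpTo_zero_apply]
  · rintro ⟨a, b⟩ hp hne
    have ha : a ≠ 1 := by
      rintro rfl
      rw [mem_factorizations, one_mul] at hp
      exact hne (Prod.ext rfl hp)
    simp [convUpTo_zero_apply, ha]
  · intro h
    exact absurd (one_mul_mem_factorizations f) h

theorem conv_convUpTo_zero_div (β : ℕ → Monics F → ℝ) (α : Monics F → ℝ) :
    dirichletConv α (fun g => convUpTo β 0 g / polyNorm g) = α := by
  funext f
  rw [dirichletConv, Finset.sum_eq_single (f, 1)]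
  · simp [convUpTo_zero_apply, polyNorm]
  · rintro ⟨a, b⟩ hp hne
    have hb : b ≠ 1 := by
      rintro rfl
      rw [mem_factorizations, mul_one] at hp
      exact hne (Prod.ext hp rfl)
    simp [convUpTo_zero_apply, hb]
  · intro h
    exact absurd (mul_one_mem_factorizations f) h

theorem alphaGL_div_polyNorm (i : ℕ) (g : Monics F) :
    alphaGL i g / polyNorm g = alphaGL (i + 1) g := by
  rw [alphaGL, alphaGL]
  split_ifs
  · rw [div_div, pow_succ]
  · exact zero_div _

theorem alphaGL_nonneg (i : ℕ) (g : Monics F) : 0 ≤ alphaGL i g := by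
  rw [alphaGL]
  split_ifs
  · exact div_nonneg zero_le_one (pow_nonneg (polyNorm_pos g).le _)
  · exact le_rfl

theorem alphaGL_one_arg (i : ℕ) : alphaGL i (1 : Monics F) = 1 := by
  simp [alphaGL, polyNorm, isCoprime_one_left]

/-- Peels off α_1 on the left instead of α_{k+1} on the right: dividing by the norm shifts α_1, …,
α_k to α_2, …, α_{k+1}. -/
theorem convUpTo_alphaGL_succ (k : ℕ) :
    convUpTo alphaGL (k + 1) =
      dirichletConv (alphaGL 1) (fun g : Monics F => convUpTo alphaGL k g / polyNorm g) := by
  induction k with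
  | zero => rw [conv_convUpTo_zero_div, convUpTo_succ, convUpTo_zero_conv]
  | succ k ih =>
    rw [convUpTo_succ, ih, dirichletConv_assoc]
    congr 1
    funext f
    rw [← ih, convUpTo_succ, ← dirichletConv_div_polyNorm]
    simp only [alphaGL_div_polyNorm]

theorem convUpTo_alphaGL_nonneg (k : ℕ) (f : Monics F) : 0 ≤ convUpTo alphaGL k f := by
  induction k generalizing f with
  | zero => rw [convUpTo_zero_apply]; split_ifs <;> norm_num
  | succ k ih =>
    rw [convUpTo_succ, dirichletConv]
    exact Finset.sum_nonneg fun p _ => mul_nonneg (ih _) (alphaGL_nonneg _ _)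

theorem convUpTo_alphaGL_of_not_isCoprime (k : ℕ) {f : Monics F} (hf : ¬ IsCoprime (f : F[X]) X) :
    convUpTo alphaGL k f = 0 := by
  induction k generalizing f with
  | zero =>
    rw [convUpTo_zero_apply, if_neg]
    rintro rfl
    exact hf isCoprime_one_left
  | succ k ih =>
    rw [convUpTo_succ, dirichletConv]
    refine Finset.sum_eq_zero fun p hp => ?_
    rw [isCoprime_X_of_mul_eq (mem_factorizations.1 hp), not_and_or] at hf
    rcases hf with h | h
    · rw [ih h, zero_mul]
    · rw [alphaGL, if_neg h, mul_zero]

/-- The factorization f · 1 alone contributes the previous value; the other terms are nonnegative.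
-/
theorem convUpTo_alphaGL_monotone (f : Monics F) : Monotone fun k => convUpTo alphaGL k f := by
  refine monotone_nat_of_le_succ fun k => ?_
  have h := Finset.single_le_sum
    (f := fun p : Monics F × Monics F => convUpTo alphaGL k p.1 * alphaGL (k + 1) p.2)
    (fun p _ => mul_nonneg (convUpTo_alphaGL_nonneg k p.1) (alphaGL_nonneg _ p.2))
    (mul_one_mem_factorizations f)
  simpa [alphaGL_one_arg, convUpTo_succ, dirichletConv] using h

theorem polyNorm_mul_convUpTo_succ (k : ℕ) {f : Monics F} (hf : IsCoprime (f : F[X]) X) :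
    polyNorm f * convUpTo alphaGL (k + 1) f =
      ∑ p ∈ (finite_factorizations f).toFinset, convUpTo alphaGL k p.2 := by
  rw [convUpTo_alphaGL_succ, dirichletConv, Finset.mul_sum]
  refine Finset.sum_congr rfl fun p hp => ?_
  have hp' := mem_factorizations.1 hp
  rw [alphaGL, if_pos ((isCoprime_X_of_mul_eq hp').1 hf).1, ← hp', polyNorm_mul, pow_one]
  have h1 := (polyNorm_pos p.1).ne'
  have h2 := (polyNorm_pos p.2).ne'
  field_simp

theorem PGL_nonneg {F : Type*} [Field F] (f : Monics F) : 0 ≤ PGL f :=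
  div_nonneg (Nat.cast_nonneg _) (Nat.cast_nonneg _)

theorem PGL_one : PGL (1 : Monics F) = 1 := by
  have hcard : Nat.card {M : Matrix.GeneralLinearGroup
        (Fin ((1 : Monics F) : F[X]).natDegree) F // M.val.charpoly = (1 : Monics F)} =
      Nat.card (Matrix.GeneralLinearGroup (Fin ((1 : Monics F) : F[X]).natDegree) F) := by
    refine Nat.card_congr (Equiv.subtypeUnivEquiv fun M => ?_)
    refine (M.val.charpoly_monic.natDegree_eq_zero).1 ?_
    rw [Matrix.charpoly_natDegree_eq_dim]
    simp
  rw [PGL, hcard]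
  exact div_self (Nat.cast_ne_zero.2 Nat.card_pos.ne')

theorem convUpTo_alphaGL_le_PGL (k : ℕ) (f : Monics F) : convUpTo alphaGL k f ≤ PGL f := by
  induction k generalizing f with
  | zero =>
    rw [convUpTo_zero_apply]
    split_ifs with h
    · rw [h, PGL_one]
    · exact PGL_nonneg f
  | succ k ih =>
    by_cases hf : IsCoprime (f : F[X]) X
    · refine le_of_mul_le_mul_left ?_ (polyNorm_pos f)
      rw [polyNorm_mul_convUpTo_succ k hf, polyNorm_mul_PGL hf]
      exact Finset.sum_le_sum fun p _ => ih p.2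
    · rw [convUpTo_alphaGL_of_not_isCoprime _ hf]
      exact PGL_nonneg f

/-- The functional equation satisfied by `PGL` and by the infinite convolution determines the
values at polynomials coprime to `X` by recursion on the degree. -/
theorem eq_of_functional_equation {A B : Monics F → ℝ} (h1 : A 1 = B 1)
    (hA : ∀ f : Monics F, IsCoprime (f : F[X]) X →
      polyNorm f * A f = ∑ p ∈ (finite_factorizations f).toFinset, A p.2)
    (hB : ∀ f : Monics F, IsCoprime (f : F[X]) X →
      polyNorm f * B f = ∑ p ∈ (finite_factorizations f).toFinset, B p.2)
    (f : Monics F) (hf : IsCoprime (f : F[X]) X) : A f = B f := by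
  classical
  induction hn : (f : F[X]).natDegree using Nat.strong_induction_on generalizing f with
  | _ n ih =>
    by_cases hf1 : f = 1
    · rw [hf1, h1]
    have hmem : ((1 : Monics F), f) ∈ (finite_factorizations f).toFinset :=
      one_mul_mem_factorizations f
    have eA := hA f hf
    have eB := hB f hf
    rw [← Finset.add_sum_erase _ _ hmem] at eA eB
    have hrest : ∑ p ∈ (finite_factorizations f).toFinset.erase (1, f), A p.2 =
        ∑ p ∈ (finite_factorizations f).toFinset.erase (1, f), B p.2 := by
      refine Finset.sum_congr rfl fun p hp => ?_
      obtain ⟨hne, hp⟩ := Finset.mem_erase.1 hp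
      rw [mem_factorizations] at hp
      have hp1 : p.1 ≠ 1 := fun h => hne (Prod.ext h (by rw [← hp, h, one_mul]))
      have hdeg := natDegree_add_of_mul_eq hp
      have hpos := natDegree_pos_of_ne_one hp1
      exact ih _ (by omega) p.2 ((isCoprime_X_of_mul_eq hp).1 hf).2 rfl
    have hN := one_lt_polyNorm hf1
    -- The term d = 1 moves to the left side; the remaining δ have smaller degree and agree by
    -- induction.
    have : (polyNorm f - 1) * (A f - B f) = 0 := by
      simp only at eA eB
      linarith
    rcases mul_eq_zero.1 this with h | h
    · linarith
    · linarith

theorem tendsto_convUpTo_alphaGL (f : Monics F) :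
    Tendsto (fun k => convUpTo alphaGL k f) atTop (𝓝 (PGL f)) := by
  have hlim : ∀ g : Monics F,
      Tendsto (fun k => convUpTo alphaGL k g) atTop (𝓝 (⨆ k, convUpTo alphaGL k g)) := fun g =>
    tendsto_atTop_ciSup (convUpTo_alphaGL_monotone g)
      ⟨PGL g, by rintro _ ⟨k, rfl⟩; exact convUpTo_alphaGL_le_PGL k g⟩
  by_cases hf : IsCoprime (f : F[X]) X
  · rw [← eq_of_functional_equation (A := fun g => ⨆ k, convUpTo alphaGL k g) (B := PGL) ?_
      (fun g hg => ?_) (fun g hg => polyNorm_mul_PGL hg) f hf]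
    · exact hlim f
    · have h : ∀ k, convUpTo alphaGL k (1 : Monics F) = 1 := fun k => by
        refine le_antisymm ((convUpTo_alphaGL_le_PGL k 1).trans_eq PGL_one) ?_
        simpa [convUpTo_zero_apply] using convUpTo_alphaGL_monotone (1 : Monics F) (Nat.zero_le k)
      simp [h, PGL_one]
    -- The recursion passes to the limit because its sum is finite.
    · refine tendsto_nhds_unique (((tendsto_add_atTop_iff_nat 1).2 (hlim g)).const_mul _) ?_
      simp only [polyNorm_mul_convUpTo_succ _ hg]
      exact tendsto_finsetSum _ fun p _ => hlim p.2
  · simp only [convUpTo_alphaGL_of_not_isCoprime _ hf, PGL_of_not_isCoprime hf]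
    exact tendsto_const_nhds

end Convolution

/-! ### Multiplicativity and boundedness of Hayes characters -/

section HayesCharacters

variable {F : Type*} [Field F]

theorem finite_quotient_hayesCon [Finite F] (ℓ : ℕ) {H : F[X]} (hH : H ≠ 0) :
    Finite (hayesCon ℓ H).Quotient := by
  have : Module.Finite F (AdjoinRoot H) := (AdjoinRoot.powerBasis hH).finite
  have : Finite (AdjoinRoot H) := Module.finite_of_finite F
  -- A class is determined by finitely many coefficients and a residue modulo `H`. The index 0 is
  -- harmless: that coefficient is always 1.
  refine Finite.of_injective (β := (Fin (ℓ + 1) → F) × AdjoinRoot H)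
    (fun x => (fun j => nextLeadingCoeff ((Quotient.out x : Monics F) : F[X]) j,
      AdjoinRoot.mk H ((Quotient.out x : Monics F) : F[X]))) fun x y h => ?_
  rw [← Quotient.out_eq x, ← Quotient.out_eq y]
  refine Quotient.sound ⟨fun j _ hj => ?_, ?_⟩
  · exact congrFun (congrArg Prod.fst h) ⟨j, Nat.lt_succ_of_le hj⟩
  · exact AdjoinRoot.mk_eq_mk.1 (congrArg Prod.snd h)

theorem hayesExtend_mul (ℓ : ℕ) (H : F[X]) (ψ : (hayesCon ℓ H).Quotientˣ →* ℂˣ) (A B : Monics F) :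
    hayesExtend ℓ H ψ (A * B) = hayesExtend ℓ H ψ A * hayesExtend ℓ H ψ B := by
  have hiff : IsUnit ((A * B : Monics F) : (hayesCon ℓ H).Quotient) ↔
      IsUnit (A : (hayesCon ℓ H).Quotient) ∧ IsUnit (B : (hayesCon ℓ H).Quotient) := by
    rw [Con.coe_mul, IsUnit.mul_iff]
  rw [hayesExtend, hayesExtend, hayesExtend]
  by_cases hA : IsUnit (A : (hayesCon ℓ H).Quotient)
  · by_cases hB : IsUnit (B : (hayesCon ℓ H).Quotient)
    · rw [dif_pos hA, dif_pos hB, dif_pos (hiff.2 ⟨hA, hB⟩), ← Units.val_mul, ← map_mul]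
      congr 2
      exact Units.ext rfl
    · rw [dif_neg hB, dif_neg (fun h => hB (hiff.1 h).2), mul_zero]
  · rw [dif_neg hA, dif_neg (fun h => hA (hiff.1 h).1), zero_mul]

theorem hayesExtend_one (ℓ : ℕ) (H : F[X]) (ψ : (hayesCon ℓ H).Quotientˣ →* ℂˣ) :
    hayesExtend ℓ H ψ 1 = 1 := by
  have h : IsUnit ((1 : Monics F) : (hayesCon ℓ H).Quotient) := isUnit_one
  rw [hayesExtend, dif_pos h]
  have : h.unit = 1 := Units.ext rfl
  rw [this, map_one, Units.val_one]

/-- The unit group is finite, so nonzero values are roots of unity. -/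
theorem norm_hayesExtend_le_one [Finite F] (ℓ : ℕ) {H : F[X]} (hH : H ≠ 0)
    (ψ : (hayesCon ℓ H).Quotientˣ →* ℂˣ) (A : Monics F) : ‖hayesExtend ℓ H ψ A‖ ≤ 1 := by
  have := finite_quotient_hayesCon ℓ hH
  rw [hayesExtend]
  split_ifs with h
  · refine (Complex.norm_eq_one_of_pow_eq_one (n := Nat.card (hayesCon ℓ H).Quotientˣ) ?_
      Nat.card_pos.ne').le
    rw [← Units.val_pow_eq_pow_val, ← map_pow, pow_card_eq_one', map_one, Units.val_one]
  · simp

end HayesCharacters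

/-! ### Summation by degree -/

section DegreeSums

variable {F : Type*} [Field F] [Fintype F]

theorem card_monics_natDegree_eq (n : ℕ) :
    Nat.card {f : Monics F // (f : F[X]).natDegree = n} = Fintype.card F ^ n := by
  have e : {f : Monics F // (f : F[X]).natDegree = n} ≃ (Fin n → F) :=
    ((Equiv.subtypeSubtypeEquivSubtypeInter (fun p : F[X] => p.Monic) fun p => p.natDegree = n).trans
      (monicEquivDegreeLT n)).trans (degreeLTEquiv F n).toEquiv
  rw [Nat.card_congr e]
  simp

instance finite_monics_natDegree_eq (n : ℕ) :
    Finite {f : Monics F // (f : F[X]).natDegree = n} :=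
  Nat.finite_of_card_ne_zero (by
    rw [card_monics_natDegree_eq]
    exact pow_ne_zero _ Fintype.card_ne_zero)

theorem summable_of_degree_sums {g : Monics F → ℝ} (hg : ∀ f, 0 ≤ g f) {b : ℕ → ℝ}
    (hb : Summable b)
    (h : ∀ n, ∑' f : {f : Monics F // (f : F[X]).natDegree = n}, g f ≤ b n) : Summable g := by
  rw [← (Equiv.sigmaFiberEquiv (fun f : Monics F => (f : F[X]).natDegree)).summable_iff,
    summable_sigma_of_nonneg (f := g ∘ Equiv.sigmaFiberEquiv
      (fun f : Monics F => (f : F[X]).natDegree)) (fun _ => hg _)]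
  exact ⟨fun n => Summable.of_finite, hb.of_nonneg_of_le (fun n => tsum_nonneg fun _ => hg _) h⟩

theorem summable_pow_natDegree {r : ℝ} (hr : 0 ≤ r) (h : r < 1 / (Fintype.card F : ℝ)) :
    Summable fun f : Monics F => r ^ (f : F[X]).natDegree := by
  have hq : (0 : ℝ) < Fintype.card F := Nat.cast_pos.2 Fintype.card_pos
  refine summable_of_degree_sums (fun f => pow_nonneg hr _) (b := fun n => (Fintype.card F * r) ^ n)
    (summable_geometric_of_lt_one (by positivity) ?_) fun n => ?_
  · rwa [lt_div_iff₀ hq, mul_comm] at h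
  · rw [tsum_congr (fun f => by rw [f.2]), tsum_const, card_monics_natDegree_eq, mul_pow]
    simp

/-- Each invertible n × n matrix has exactly one characteristic polynomial, monic of degree n. -/
theorem tsum_PGL_natDegree_eq (n : ℕ) :
    ∑' f : {f : Monics F // (f : F[X]).natDegree = n}, PGL (f : Monics F) = 1 := by
  have : Fintype {f : Monics F // (f : F[X]).natDegree = n} := Fintype.ofFinite _
  have h1 : ∀ f : {f : Monics F // (f : F[X]).natDegree = n}, PGL (f : Monics F) =
      (Nat.card {M : Matrix.GeneralLinearGroup (Fin n) F // M.val.charpoly = (f : Monics F)} : ℝ) /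
        Nat.card (Matrix.GeneralLinearGroup (Fin n) F) := by
    rintro ⟨f, rfl⟩
    rfl
  simp only [h1, tsum_fintype]
  rw [← Finset.sum_div, ← Nat.cast_sum, ← Nat.card_sigma, div_eq_one_iff_eq
    (Nat.cast_ne_zero.2 Nat.card_pos.ne')]
  congr 1
  refine Nat.card_eq_of_bijective (fun s => s.2.1) ⟨fun s t h => ?_, fun M => ?_⟩
  · obtain ⟨⟨⟨f, hf⟩, hn⟩, M, hM⟩ := s
    obtain ⟨⟨⟨f', hf'⟩, hn'⟩, M', hM'⟩ := t
    obtain rfl : M = M' := h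
    obtain rfl : _ = f := hM
    obtain rfl : _ = f' := hM'
    rfl
  · exact ⟨⟨⟨⟨M.val.charpoly, M.val.charpoly_monic⟩,
      by simp [Matrix.charpoly_natDegree_eq_dim]⟩, M, rfl⟩, rfl⟩

theorem summable_PGL_mul_pow {r : ℝ} (hr : 0 ≤ r) (h : r < 1) :
    Summable fun f : Monics F => PGL f * r ^ (f : F[X]).natDegree := by
  refine summable_of_degree_sums (fun f => mul_nonneg (PGL_nonneg f) (pow_nonneg hr _))
    (summable_geometric_of_lt_one hr h) fun n => ?_
  rw [tsum_congr (fun f => by rw [f.2]), tsum_mul_right, tsum_PGL_natDegree_eq, one_mul]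

end DegreeSums

/-! ### The infinite product -/

section EulerProduct

variable {F : Type*} [Field F] [Fintype F] {χ : Monics F → ℂ}

/-- The term at `f` of the generating series of `α` twisted by `χ`. -/
def twistedTerm (χ : Monics F → ℂ) (u : ℂ) (α : Monics F → ℝ) (f : Monics F) : ℂ :=
  (α f : ℂ) * χ f * u ^ (f : F[X]).natDegree

omit [Fintype F] in
theorem norm_twistedTerm_le (hb : ∀ f, ‖χ f‖ ≤ 1) (u : ℂ) {α : Monics F → ℝ} (hα : ∀ f, 0 ≤ α f)
    (f : Monics F) : ‖twistedTerm χ u α f‖ ≤ α f * ‖u‖ ^ (f : F[X]).natDegree := by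
  rw [twistedTerm, norm_mul, norm_mul, norm_pow, Complex.norm_real, Real.norm_of_nonneg (hα f)]
  exact mul_le_mul_of_nonneg_right (mul_le_of_le_one_right (hα f) (hb f)) (by positivity)

theorem LGL_div_pow_eq_tsum (χ : Monics F → ℂ) (u : ℂ) (i : ℕ) :
    LGL (u / (Fintype.card F : ℂ) ^ i) χ = ∑' f, twistedTerm χ u (alphaGL i) f := by
  classical
  rw [LGL]
  refine (tsum_subtype {f : Monics F | IsCoprime (f : F[X]) X}
    (fun f => χ f * (u / (Fintype.card F : ℂ) ^ i) ^ (f : F[X]).natDegree)).trans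
    (tsum_congr fun f => ?_)
  rw [Set.indicator_apply, twistedTerm, alphaGL]
  simp only [Set.mem_ofPred_eq]
  split_ifs with h
  · rw [polyNorm]
    push_cast
    rw [div_pow, ← pow_mul, ← pow_mul, mul_comm i]
    ring
  · simp

theorem alphaGL_le (i : ℕ) (f : Monics F) : alphaGL i f ≤ 1 / polyNorm f ^ i := by
  rw [alphaGL]
  split_ifs
  · exact le_rfl
  · exact div_nonneg zero_le_one (pow_nonneg (polyNorm_pos f).le _)

theorem summable_alphaGL_mul_pow {r : ℝ} (hr : 0 ≤ r) (h : r < 1) (i : ℕ) :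
    Summable fun f : Monics F => alphaGL (i + 1) f * r ^ (f : F[X]).natDegree := by
  have hq : (1 : ℝ) ≤ Fintype.card F := Nat.one_le_cast.2 Fintype.card_pos
  have hq' : (0 : ℝ) < Fintype.card F ^ (i + 1) := pow_pos (zero_lt_one.trans_le hq) _
  refine (summable_pow_natDegree (F := F) (r := r / Fintype.card F ^ (i + 1))
    (div_nonneg hr hq'.le) ?_).of_nonneg_of_le (fun f => mul_nonneg (alphaGL_nonneg _ _)
      (pow_nonneg hr _)) fun f => ?_
  · refine (div_lt_div_of_pos_right h hq').trans_le ?_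
    exact one_div_le_one_div_of_le (zero_lt_one.trans_le hq) (le_self_pow₀ hq i.succ_ne_zero)
  · refine (mul_le_mul_of_nonneg_right (alphaGL_le _ f) (pow_nonneg hr _)).trans_eq ?_
    rw [polyNorm, div_pow, ← pow_mul, ← pow_mul, mul_comm (i + 1)]
    ring

/-- Absolute convergence allows the double series to be regrouped by the product of its two indices.
-/
theorem tsum_twistedTerm_dirichletConv (hmul : ∀ f g, χ (f * g) = χ f * χ g) (u : ℂ)
    {α β : Monics F → ℝ} (hα : Summable fun f => ‖twistedTerm χ u α f‖)
    (hβ : Summable fun f => ‖twistedTerm χ u β f‖) :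
    ∑' f, twistedTerm χ u (dirichletConv α β) f =
      (∑' f, twistedTerm χ u α f) * ∑' f, twistedTerm χ u β f := by
  rw [tsum_mul_tsum_of_summable_norm hα hβ,
    ← (Equiv.sigmaFiberEquiv (fun p : Monics F × Monics F => p.1 * p.2)).tsum_eq,
    Summable.tsum_sigma']
  · refine tsum_congr fun f => ?_
    have hset : (∑' p : {p : Monics F × Monics F // p.1 * p.2 = f},
        twistedTerm χ u α p.1.1 * twistedTerm χ u β p.1.2) =
        ∑ p ∈ (finite_factorizations f).toFinset,
          twistedTerm χ u α p.1 * twistedTerm χ u β p.2 := by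
      rw [← Finset.tsum_subtype' (finite_factorizations f).toFinset
        (fun p => twistedTerm χ u α p.1 * twistedTerm χ u β p.2), Set.Finite.coe_toFinset]
      rfl
    refine Eq.trans ?_ hset.symm
    rw [twistedTerm, dirichletConv, Complex.ofReal_sum, Finset.sum_mul, Finset.sum_mul]
    refine Finset.sum_congr rfl fun p hp => ?_
    have hp' := mem_factorizations.1 hp
    rw [twistedTerm, twistedTerm, ← natDegree_add_of_mul_eq hp', ← hp', hmul, pow_add,
      Complex.ofReal_mul]
    ring
  · intro f
    have : Finite {p : Monics F × Monics F // p.1 * p.2 = f} := finite_factorizations f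
    exact Summable.of_finite
  · exact (Equiv.sigmaFiberEquiv (fun p : Monics F × Monics F => p.1 * p.2)).summable_iff.2
      (summable_mul_of_summable_norm hα hβ)

theorem prod_LGL_eq_tsum (hmul : ∀ f g, χ (f * g) = χ f * χ g) (h1 : χ 1 = 1)
    (hb : ∀ f, ‖χ f‖ ≤ 1) {u : ℂ} (hu : ‖u‖ < 1) (k : ℕ) :
    ∏ i ∈ Finset.range k, LGL (u / (Fintype.card F : ℂ) ^ (i + 1)) χ =
      ∑' f, twistedTerm χ u (convUpTo alphaGL k) f := by
  induction k with
  | zero =>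
    rw [Finset.prod_range_zero, tsum_eq_single 1]
    · simp [twistedTerm, convUpTo_zero_apply, h1]
    · intro f hf
      simp [twistedTerm, convUpTo_zero_apply, hf]
  | succ k ih =>
    rw [Finset.prod_range_succ, ih, LGL_div_pow_eq_tsum, convUpTo_succ,
      tsum_twistedTerm_dirichletConv hmul]
    · refine (summable_PGL_mul_pow (F := F) (norm_nonneg u) hu).of_nonneg_of_le
        (fun _ => norm_nonneg _) fun f => ?_
      refine (norm_twistedTerm_le hb u (convUpTo_alphaGL_nonneg k) f).trans ?_
      exact mul_le_mul_of_nonneg_right (convUpTo_alphaGL_le_PGL k f) (by positivity)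
    · exact (summable_alphaGL_mul_pow (norm_nonneg u) hu k).of_nonneg_of_le
        (fun _ => norm_nonneg _) (norm_twistedTerm_le hb u (alphaGL_nonneg _))

theorem tendsto_prod_LGL (hmul : ∀ f g, χ (f * g) = χ f * χ g) (h1 : χ 1 = 1)
    (hb : ∀ f, ‖χ f‖ ≤ 1) {u : ℂ} (hu : ‖u‖ < 1) :
    Tendsto (fun k => ∏ i ∈ Finset.range k, LGL (u / (Fintype.card F : ℂ) ^ (i + 1)) χ) atTop
      (𝓝 (∑' f, twistedTerm χ u PGL f)) := by
  simp only [prod_LGL_eq_tsum hmul h1 hb hu]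
  refine tendsto_tsum_of_dominated_convergence (summable_PGL_mul_pow (F := F) (norm_nonneg u) hu)
    (fun f => ?_) (Eventually.of_forall fun k f => ?_)
  · exact (((Complex.continuous_ofReal.tendsto _).comp (tendsto_convUpTo_alphaGL f)).mul_const
      _).mul_const _
  · refine (norm_twistedTerm_le hb u (convUpTo_alphaGL_nonneg k) f).trans ?_
    exact mul_le_mul_of_nonneg_right (convUpTo_alphaGL_le_PGL k f) (by positivity)

theorem summable_norm_LGL_sub_one (h1 : χ 1 = 1) (hb : ∀ f, ‖χ f‖ ≤ 1) {u : ℂ} (hu : ‖u‖ < 1) :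
    Summable fun i : ℕ => ‖LGL (u / (Fintype.card F : ℂ) ^ (i + 1)) χ - 1‖ := by
  classical
  have hq : (1 : ℝ) < Fintype.card F := Nat.one_lt_cast.2 Fintype.one_lt_card
  have hq0 : (0 : ℝ) < Fintype.card F := zero_lt_one.trans hq
  have hC := summable_pow_natDegree (F := F) (r := ‖u‖ / Fintype.card F)
    (div_nonneg (norm_nonneg u) hq0.le) (div_lt_div_of_pos_right hu hq0)
  have hgeo : Summable fun i : ℕ => (1 / (Fintype.card F : ℝ)) ^ i :=
    summable_geometric_of_lt_one (by positivity) ((div_lt_one hq0).2 hq)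
  refine (hgeo.mul_right (∑' f : Monics F, (‖u‖ / Fintype.card F) ^ (f : F[X]).natDegree)
    ).of_nonneg_of_le (fun _ => norm_nonneg _) fun i => ?_
  have hs : Summable (twistedTerm χ u (alphaGL (i + 1))) :=
    Summable.of_norm ((summable_alphaGL_mul_pow (norm_nonneg u) hu i).of_nonneg_of_le
      (fun _ => norm_nonneg _) (norm_twistedTerm_le hb u (alphaGL_nonneg _)))
  rw [LGL_div_pow_eq_tsum, ← (hs.hasSum.sub (hasSum_ite_eq (1 : Monics F) (1 : ℂ))).tsum_eq]
  -- The 1 cancels the term at f = 1. For other f, |f| ≥ q lets q^{-i} be extracted, leaving a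
  -- convergent series independent of i.
  refine tsum_of_norm_bounded (hC.hasSum.mul_left _) fun f => ?_
  by_cases hf : f = 1
  · rw [hf, if_pos rfl, twistedTerm, alphaGL_one_arg, h1]
    simp
  · rw [if_neg hf, sub_zero]
    refine (norm_twistedTerm_le hb u (alphaGL_nonneg _) f).trans ?_
    refine (mul_le_mul_of_nonneg_right (alphaGL_le _ f) (by positivity)).trans ?_
    have hN := one_lt_polyNorm hf
    have hle : (Fintype.card F : ℝ) ≤ polyNorm f :=
      le_self_pow₀ hq.le (natDegree_pos_of_ne_one hf).ne'
    have hinv : 1 / polyNorm f ≤ 1 / (Fintype.card F : ℝ) := one_div_le_one_div_of_le hq0 hle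
    have hpow : (1 / polyNorm f) ^ i ≤ (1 / (Fintype.card F : ℝ)) ^ i :=
      pow_le_pow_left₀ (one_div_nonneg.2 (polyNorm_pos f).le) hinv i
    calc 1 / polyNorm f ^ (i + 1) * ‖u‖ ^ (f : F[X]).natDegree
        = (1 / polyNorm f) ^ i * (‖u‖ / Fintype.card F) ^ (f : F[X]).natDegree := by
          rw [div_pow, div_pow, one_pow, ← polyNorm, pow_succ]
          ring
      _ ≤ _ := mul_le_mul_of_nonneg_right hpow (by positivity)

theorem hasProd_LGL (hmul : ∀ f g, χ (f * g) = χ f * χ g) (h1 : χ 1 = 1)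
    (hb : ∀ f, ‖χ f‖ ≤ 1) {u : ℂ} (hu : ‖u‖ < 1) :
    HasProd (fun i : ℕ => LGL (u / (Fintype.card F : ℂ) ^ (i + 1)) χ)
      (∑' f, twistedTerm χ u PGL f) := by
  -- Absolute convergence gives an unordered product; its value is then read off along initial
  -- segments.
  have h := multipliable_one_add_of_summable (summable_norm_LGL_sub_one h1 hb hu)
  simp only [add_sub_cancel] at h
  have hp := h.hasProd
  rwa [tendsto_nhds_unique hp.tendsto_prod_nat (tendsto_prod_LGL hmul h1 hb hu)] at hp

end EulerProduct

end GLCharpoly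

end

theorem theorem3p3 {F : Type*} [Field F] [Fintype F] :
    (∀ f : GLCharpoly.Monics F,
      Tendsto (fun k : ℕ => GLCharpoly.convUpTo GLCharpoly.alphaGL k f) atTop
        (𝓝 (GLCharpoly.PGL f))) ∧
    (∀ χ : GLCharpoly.Monics F → ℂ, GLCharpoly.IsHayesCharacter χ →
      (∀ u : ℂ, ‖u‖ < 1 / (Fintype.card F : ℝ) →
        Summable (fun f : {f : GLCharpoly.Monics F // IsCoprime (f : F[X]) X} =>
          ‖χ f * u ^ ((f : GLCharpoly.Monics F) : F[X]).natDegree‖)) ∧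
      (∀ u : ℂ, ‖u‖ < 1 →
        Summable (fun f : GLCharpoly.Monics F =>
          ‖(GLCharpoly.PGL f : ℂ) * χ f * u ^ (f : F[X]).natDegree‖) ∧
        Summable (fun i : ℕ =>
          ‖GLCharpoly.LGL (u / (Fintype.card F : ℂ) ^ (i + 1)) χ - 1‖) ∧
        HasProd (fun i : ℕ => GLCharpoly.LGL (u / (Fintype.card F : ℂ) ^ (i + 1)) χ)
          (∑' f : GLCharpoly.Monics F,
            (GLCharpoly.PGL f : ℂ) * χ f * u ^ (f : F[X]).natDegree))) := by
  refine ⟨GLCharpoly.tendsto_convUpTo_alphaGL, ?_⟩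
  rintro χ ⟨ℓ, H, hH, ψ, rfl⟩
  have hmul := GLCharpoly.hayesExtend_mul ℓ H ψ
  have h1 := GLCharpoly.hayesExtend_one ℓ H ψ
  have hb := GLCharpoly.norm_hayesExtend_le_one ℓ hH ψ
  refine ⟨fun u hu => ?_, fun u hu => ⟨?_, GLCharpoly.summable_norm_LGL_sub_one h1 hb hu,
    GLCharpoly.hasProd_LGL hmul h1 hb hu⟩⟩
  · refine ((GLCharpoly.summable_pow_natDegree (norm_nonneg u) hu).comp_injective
      Subtype.val_injective).of_nonneg_of_le (fun _ => norm_nonneg _) fun f => ?_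
    rw [norm_mul, norm_pow]
    exact mul_le_of_le_one_left (by positivity) (hb f)
  · exact (GLCharpoly.summable_PGL_mul_pow (norm_nonneg u) hu).of_nonneg_of_le
      (fun _ => norm_nonneg _) (GLCharpoly.norm_twistedTerm_le hb u GLCharpoly.PGL_nonneg)
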